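/- Let $p\ge 0$, let $S\in\mathbb R^{p\times p}$ be symmetric positive semidefinite, and let $\Lambda=[\lambda_{ij}]\in\mathbb R^{p\times p}$ be symmetric with nonnegative entries. Assume that either (a) $\lambda_{ij}>0$ for all $i\neq j$ and $S_{ii}>0$ for all $i$, or (b) $\lambda_{ii}>0$ for all $i$. For $X\succ0$ put $g(X)=-\log\det X+\operatorname{tr}(SX)$, $\|X\|_{1,\Lambda}=\sum_{i,j}\lambda_{ij}|X_{ij}|$ and $f(X)=g(X)+\|X\|_{1,\Lambda}$; thus $\nabla g(X)=S-X^{-1}$ and $\nabla^2g(X)=X^{-1}\otimes X^{-1}$. Fix $0<\sigma<\tfrac12$, $0<\beta<1$ and $X_0\succ0$. The QUIC algorithm with exact Newton directions generates $X_1,X_2,\dots$ from $X_0$ as follows. Given $X_t$, let the fixed set be $\{(i,j): |\nabla_{ij}g(X_t)|\le\lambda_{ij},\ (X_t)_{ij}=0\}$ (in every iteration; or, in every iteration, the same set with $<$ in place of $\le$), and let the free set $J_t$ be its complement. Let $D_t$ be the minimizer of $$\operatorname{tr}(\nabla g(X_t)^TD)+\tfrac12\operatorname{vec}(D)^T\nabla^2g(X_t)\operatorname{vec}(D)+\|X_t+D\|_{1,\Lambda}$$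 over the symmetric matrices $D$ with $D_{ij}=0$ for all $(i,j)\notin J_t$. Let $\alpha_t=\beta^k$ with the smallest $k\in\{0,1,2,\dots\}$ such that $X_t+\beta^kD_t\succ0$ and $f(X_t+\beta^kD_t)\le f(X_t)+\beta^k\sigma\delta_t$, where $\delta_t=\operatorname{tr}(\nabla g(X_t)^TD_t)+\|X_t+D_t\|_{1,\Lambda}-\|X_t\|_{1,\Lambda}$. Put $X_{t+1}=X_t+\alpha_tD_t$. Then $f$ has a unique minimizer $X^*$ over the symmetric positive definite matrices, the algorithm is well defined (it generates an infinite sequence), and $\{X_t\}$ converges quadratically to $X^*$: $X_t\to X^*$, and there is a constant $C>0$ such that $\|X_{t+1}-X^*\|_F\le C\|X_t-X^*\|_F^2$ for all sufficiently large $t$. -/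

import Mathlib

open scoped Topology

namespace QUIC

noncomputable section

/-- The smooth part `g(X) = -log det X + tr(S X)` (used at positive definite `X` only). -/
def smoothPart {p : ℕ} (S X : Matrix (Fin p) (Fin p) ℝ) : ℝ :=
  -Real.log X.det + (S * X).trace

/-- The weighted `ℓ₁` norm `‖X‖_{1,Λ} = ∑_{i,j} λ_{ij} |X_{ij}|`, over all ordered pairs. -/
def weightedL1 {p : ℕ} (Λ X : Matrix (Fin p) (Fin p) ℝ) : ℝ :=
  ∑ i, ∑ j, Λ i j * |X i j|

/-- The objective `f = g + ‖·‖_{1,Λ}` (used at positive definite `X` only). -/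
def objective {p : ℕ} (S Λ X : Matrix (Fin p) (Fin p) ℝ) : ℝ :=
  smoothPart S X + weightedL1 Λ X

/-- `X` minimizes the objective over the symmetric positive definite matrices. -/
def IsMinimizer {p : ℕ} (S Λ X : Matrix (Fin p) (Fin p) ℝ) : Prop :=
  X.PosDef ∧ ∀ Y : Matrix (Fin p) (Fin p) ℝ, Y.PosDef → objective S Λ X ≤ objective S Λ Y

/-- The gradient `∇g(X) = S - X⁻¹`. -/
def gradient {p : ℕ} (S X : Matrix (Fin p) (Fin p) ℝ) : Matrix (Fin p) (Fin p) ℝ :=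
  S - X⁻¹

/-- The Hessian form `vec(D)ᵀ (X⁻¹ ⊗ X⁻¹) vec(D) = tr(X⁻¹ D X⁻¹ D)` for symmetric `X`, `D`. -/
def hessianForm {p : ℕ} (X D : Matrix (Fin p) (Fin p) ℝ) : ℝ :=
  (X⁻¹ * D * X⁻¹ * D).trace

/-- The fixed set `{(i,j) : |∇_{ij} g(X)| ≤ λ_{ij} and X_{ij} = 0}`. -/
def fixedSet {p : ℕ} (S Λ X : Matrix (Fin p) (Fin p) ℝ) : Set (Fin p × Fin p) :=
  {ij | |gradient S X ij.1 ij.2| ≤ Λ ij.1 ij.2 ∧ X ij.1 ij.2 = 0}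

/-- The variant of the fixed set with a strict inequality:
`{(i,j) : |∇_{ij} g(X)| < λ_{ij} and X_{ij} = 0}`. -/
def strictFixedSet {p : ℕ} (S Λ X : Matrix (Fin p) (Fin p) ℝ) : Set (Fin p × Fin p) :=
  {ij | |gradient S X ij.1 ij.2| < Λ ij.1 ij.2 ∧ X ij.1 ij.2 = 0}

/-- The `ℓ₁`-regularized quadratic model
`tr(∇g(X)ᵀ D) + ½ vec(D)ᵀ ∇²g(X) vec(D) + ‖X + D‖_{1,Λ}`. -/
def quadraticModel {p : ℕ} (S Λ X D : Matrix (Fin p) (Fin p) ℝ) : ℝ :=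
  ((gradient S X).transpose * D).trace + hessianForm X D / 2 + weightedL1 Λ (X + D)

/-- The symmetric matrices supported in the index set `J`. -/
def supportedDirections {p : ℕ} (J : Set (Fin p × Fin p)) :
    Set (Matrix (Fin p) (Fin p) ℝ) :=
  {D | D.IsSymm ∧ ∀ i j, (i, j) ∉ J → D i j = 0}

/-- `D` is an exact Newton direction at `X` restricted to `J`: a minimizer of the quadratic
model over the symmetric matrices supported in `J`. -/
def IsNewtonDirection {p : ℕ} (S Λ X : Matrix (Fin p) (Fin p) ℝ) (J : Set (Fin p × Fin p))
    (D : Matrix (Fin p) (Fin p) ℝ) : Prop :=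
  D ∈ supportedDirections J ∧
    ∀ E ∈ supportedDirections J, quadraticModel S Λ X D ≤ quadraticModel S Λ X E

/-- The predicted decrease `δ = tr(∇g(X)ᵀ D) + ‖X + D‖_{1,Λ} - ‖X‖_{1,Λ}`. -/
def predictedDecrease {p : ℕ} (S Λ X D : Matrix (Fin p) (Fin p) ℝ) : ℝ :=
  ((gradient S X).transpose * D).trace + weightedL1 Λ (X + D) - weightedL1 Λ X

/-- The line search condition: `X + α D` is positive definite and
`f(X + α D) ≤ f(X) + α σ δ`. -/
def LineSearchCondition {p : ℕ} (S Λ : Matrix (Fin p) (Fin p) ℝ) (σ : ℝ)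
    (X D : Matrix (Fin p) (Fin p) ℝ) (α : ℝ) : Prop :=
  (X + α • D).PosDef ∧
    objective S Λ (X + α • D) ≤ objective S Λ X + α * σ * predictedDecrease S Λ X D

/-- `α` is the Armijo step size: `α = β ^ k` for the smallest `k` whose step is accepted. -/
def IsArmijoStep {p : ℕ} (S Λ : Matrix (Fin p) (Fin p) ℝ) (σ β : ℝ)
    (X D : Matrix (Fin p) (Fin p) ℝ) (α : ℝ) : Prop :=
  ∃ k : ℕ, α = β ^ k ∧ LineSearchCondition S Λ σ X D (β ^ k) ∧
    ∀ l < k, ¬ LineSearchCondition S Λ σ X D (β ^ l)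

/-- `X` is a sequence generated by QUIC from `X₀`, where `fixed` is the rule that selects the
fixed set at an iterate; the free set is its complement. -/
structure IsQUICSequence {p : ℕ} (S Λ : Matrix (Fin p) (Fin p) ℝ) (σ β : ℝ)
    (fixed : Matrix (Fin p) (Fin p) ℝ → Set (Fin p × Fin p))
    (X₀ : Matrix (Fin p) (Fin p) ℝ) (X : ℕ → Matrix (Fin p) (Fin p) ℝ) : Prop where
  init : X 0 = X₀
  step : ∀ t, ∃ (D : Matrix (Fin p) (Fin p) ℝ) (α : ℝ),
    IsNewtonDirection S Λ (X t) (fixed (X t))ᶜ D ∧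
    IsArmijoStep S Λ σ β (X t) D α ∧
    X (t + 1) = X t + α • D

/-- The Frobenius norm. -/
def frobenius {p : ℕ} (A : Matrix (Fin p) (Fin p) ℝ) : ℝ :=
  Real.sqrt (∑ i, ∑ j, A i j ^ 2)

/-- Quadratic convergence: `X t → L` and, for some constant `C`, eventually
`‖X (t+1) - L‖_F ≤ C ‖X t - L‖_F ^ 2`. -/
def ConvergesQuadratically {p : ℕ} (X : ℕ → Matrix (Fin p) (Fin p) ℝ)
    (L : Matrix (Fin p) (Fin p) ℝ) : Prop :=
  Filter.Tendsto X Filter.atTop (𝓝 L) ∧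
    ∃ C : ℝ, 0 < C ∧ ∀ᶠ t in Filter.atTop,
      frobenius (X (t + 1) - L) ≤ C * frobenius (X t - L) ^ 2

end

end QUIC

namespace QUIC

open Matrix Filter
open scoped Matrix.Norms.Frobenius

/-! ### Frobenius norm, simultaneous diagonalisation and the Hessian form. -/

section LinearAlgebra

variable {p : ℕ} {X D : Matrix (Fin p) (Fin p) ℝ}

theorem norm_sq_eq_sum (A : Matrix (Fin p) (Fin p) ℝ) : ‖A‖ ^ 2 = ∑ i, ∑ j, A i j ^ 2 := by
  rw [frobenius_norm_def, ← Real.sqrt_eq_rpow, Real.sq_sqrt (by positivity)]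
  simp

theorem frobenius_eq_norm (A : Matrix (Fin p) (Fin p) ℝ) : frobenius A = ‖A‖ := by
  rw [frobenius, ← norm_sq_eq_sum, Real.sqrt_sq (norm_nonneg A)]

theorem trace_transpose_mul_eq_sum (A B : Matrix (Fin p) (Fin p) ℝ) :
    (Aᵀ * B).trace = ∑ i, ∑ j, A i j * B i j := by
  simp only [trace, diag_apply, mul_apply, transpose_apply]
  exact Finset.sum_comm

theorem trace_transpose_mul_self (A : Matrix (Fin p) (Fin p) ℝ) :
    (Aᵀ * A).trace = ‖A‖ ^ 2 := by
  rw [trace_transpose_mul_eq_sum, norm_sq_eq_sum]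
  simp only [sq]

theorem abs_trace_transpose_mul_le (A B : Matrix (Fin p) (Fin p) ℝ) :
    |(Aᵀ * B).trace| ≤ ‖A‖ * ‖B‖ := by
  refine abs_le_of_sq_le_sq ?_ (by positivity)
  rw [mul_pow, norm_sq_eq_sum, norm_sq_eq_sum, trace_transpose_mul_eq_sum]
  simp only [← Finset.sum_product']
  exact Finset.sum_mul_sq_le_sq_mul_sq _ _ _

theorem abs_trace_mul_le (A B : Matrix (Fin p) (Fin p) ℝ) :
    |(A * B).trace| ≤ ‖A‖ * ‖B‖ := by
  simpa [frobenius_norm_transpose] using abs_trace_transpose_mul_le Aᵀ B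

theorem _root_.Matrix.PosDef.isSymm (hX : X.PosDef) : X.IsSymm := by
  have h := hX.isHermitian.eq
  rwa [conjTranspose_eq_transpose_of_trivial] at h

theorem isHermitian_of_isSymm (hD : D.IsSymm) : D.IsHermitian := by
  rw [IsHermitian, conjTranspose_eq_transpose_of_trivial]; exact hD

theorem isSymm_inv (hX : X.IsSymm) : X⁻¹.IsSymm := by
  rw [IsSymm, transpose_nonsing_inv, hX.eq]

/-- A positive definite and a symmetric matrix are diagonalised by a common congruence. -/
theorem exists_congruence (hX : X.PosDef) (hD : D.IsSymm) :
    ∃ (C : Matrix (Fin p) (Fin p) ℝ) (e : Fin p → ℝ), IsUnit C ∧ X = Cᵀ * C ∧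
      D = Cᵀ * diagonal e * C := by
  open scoped MatrixOrder in
  obtain ⟨B, hB⟩ := CStarAlgebra.nonneg_iff_eq_star_mul_self.1 hX.posSemidef.nonneg
  rw [star_eq_conjTranspose, conjTranspose_eq_transpose_of_trivial] at hB
  have hBu : IsUnit B := by
    have h := hX.isUnit
    rw [hB] at h
    exact isUnit_of_mul_isUnit_right h
  have hBd : IsUnit B.det := (isUnit_iff_isUnit_det B).1 hBu
  have hBB : B⁻¹ * B = 1 := nonsing_inv_mul B hBd
  have hBB' : Bᵀ * B⁻¹ᵀ = 1 := by rw [← transpose_mul, hBB, transpose_one]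
  -- Congruence by B⁻¹ turns X into the identity, which an orthogonal U preserves; diagonalising the
  -- transported D gives C = UᵀB.
  have hE : (B⁻¹ᵀ * D * B⁻¹).IsHermitian := by
    apply isHermitian_of_isSymm
    simp [IsSymm, transpose_mul, hD.eq, Matrix.mul_assoc]
  have hs := hE.spectral_theorem
  rw [Unitary.conjStarAlgAut_apply] at hs
  set U : Matrix (Fin p) (Fin p) ℝ := (hE.eigenvectorUnitary : Matrix (Fin p) (Fin p) ℝ)
  have hU : U * Uᵀ = 1 := by
    have := (Unitary.mem_iff.1 hE.eigenvectorUnitary.2).2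
    rwa [star_eq_conjTranspose, conjTranspose_eq_transpose_of_trivial] at this
  have hU' : star U = Uᵀ := by
    rw [star_eq_conjTranspose, conjTranspose_eq_transpose_of_trivial]
  refine ⟨Uᵀ * B, hE.eigenvalues, ?_, ?_, ?_⟩
  · exact (IsUnit.of_mul_eq_one U (mul_eq_one_comm.1 hU)).mul hBu
  · rw [transpose_mul, transpose_transpose, Matrix.mul_assoc, ← Matrix.mul_assoc U, hU,
      Matrix.one_mul, hB]
  · calc D = (Bᵀ * B⁻¹ᵀ) * D * (B⁻¹ * B) := by rw [hBB, hBB']; simp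
      _ = Bᵀ * (B⁻¹ᵀ * D * B⁻¹) * B := by simp only [Matrix.mul_assoc]
      _ = Bᵀ * (U * diagonal hE.eigenvalues * Uᵀ) * B := by
          rw [← hU']; exact congrArg (fun M => Bᵀ * M * B) hs
      _ = _ := by rw [transpose_mul, transpose_transpose]; simp only [Matrix.mul_assoc]

/-- Generalised eigenvalues `e` of a symmetric matrix `D` relative to a positive definite `X`,
with the quantities that they determine. -/
theorem exists_relative_eigenvalues (hX : X.PosDef) (hD : D.IsSymm) :
    ∃ e : Fin p → ℝ, (X⁻¹ * D).trace = ∑ i, e i ∧ hessianForm X D = ∑ i, e i ^ 2 ∧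
      (X + D).det = X.det * ∏ i, (1 + e i) ∧ ((X + D).PosDef ↔ ∀ i, 0 < 1 + e i) ∧
      ‖D‖ ^ 2 ≤ X.trace ^ 2 * ∑ i, e i ^ 2 := by
  obtain ⟨C, e, hC, rfl, rfl⟩ := exists_congruence hX hD
  have hCd : IsUnit C.det := (isUnit_iff_isUnit_det C).1 hC
  have hCC : C * C⁻¹ = 1 := mul_nonsing_inv C hCd
  have hCC' : Cᵀ⁻¹ * Cᵀ = 1 := nonsing_inv_mul _ (by rwa [det_transpose])
  have hXD : (Cᵀ * C)⁻¹ * (Cᵀ * diagonal e * C) = C⁻¹ * diagonal e * C := by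
    rw [Matrix.mul_inv_rev]
    calc C⁻¹ * Cᵀ⁻¹ * (Cᵀ * diagonal e * C) = C⁻¹ * (Cᵀ⁻¹ * Cᵀ) * diagonal e * C := by
          simp only [Matrix.mul_assoc]
      _ = _ := by rw [hCC', Matrix.mul_one]
  have hsum : Cᵀ * C + Cᵀ * diagonal e * C = Cᵀ * diagonal (fun i => 1 + e i) * C := by
    have : diagonal (fun i => 1 + e i) = 1 + diagonal e := by
      rw [← diagonal_one, diagonal_add]
    rw [this, Matrix.mul_add, Matrix.add_mul, Matrix.mul_one]
  refine ⟨e, ?_, ?_, ?_, ?_, ?_⟩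
  · rw [hXD, trace_mul_comm, ← Matrix.mul_assoc, hCC, Matrix.one_mul, trace_diagonal]
  · rw [hessianForm, Matrix.mul_assoc, hXD]
    have : C⁻¹ * diagonal e * C * (C⁻¹ * diagonal e * C)
        = C⁻¹ * (diagonal e * (C * C⁻¹) * diagonal e * C) := by
      simp only [Matrix.mul_assoc]
    rw [this, trace_mul_comm, hCC, Matrix.mul_one, diagonal_mul_diagonal, Matrix.mul_assoc, hCC,
      Matrix.mul_one, trace_diagonal]
    simp only [sq]
  · rw [hsum]
    simp only [det_mul, det_transpose, det_diagonal]
    ring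
  · have h := (hC.star).posDef_star_right_conjugate_iff (x := diagonal (fun i => 1 + e i))
    rw [star_star, star_eq_conjTranspose, conjTranspose_eq_transpose_of_trivial] at h
    rw [hsum, h, posDef_diagonal_iff]
  · have hn : ‖diagonal e‖ ^ 2 = ∑ i, e i ^ 2 := by
      rw [← trace_transpose_mul_self, diagonal_transpose, diagonal_mul_diagonal, trace_diagonal]
      simp only [sq]
    -- The trace enters because ‖C‖² = tr(CᵀC) = tr X.
    have hle : ‖Cᵀ * diagonal e * C‖ ≤ ‖C‖ ^ 2 * ‖diagonal e‖ := by
      calc _ ≤ ‖Cᵀ‖ * ‖diagonal e‖ * ‖C‖ :=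
            (norm_mul_le _ _).trans (by gcongr; exact norm_mul_le _ _)
        _ = _ := by rw [frobenius_norm_transpose]; ring
    rw [trace_transpose_mul_self, ← hn, ← mul_pow]
    exact pow_le_pow_left₀ (norm_nonneg _) hle 2

theorem norm_le_trace (hX : X.PosDef) : ‖X‖ ≤ X.trace := by
  obtain ⟨C, -, -, h, -⟩ := exists_congruence (D := 0) hX isSymm_zero
  rw [h, trace_transpose_mul_self, sq]
  exact (norm_mul_le _ _).trans_eq (by rw [frobenius_norm_transpose])

theorem hessianForm_nonneg (hX : X.PosDef) (hD : D.IsSymm) : 0 ≤ hessianForm X D := by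
  obtain ⟨e, -, h, -⟩ := exists_relative_eigenvalues hX hD
  rw [h]; positivity

theorem norm_sq_le_hessianForm (hX : X.PosDef) (hD : D.IsSymm) :
    ‖D‖ ^ 2 ≤ X.trace ^ 2 * hessianForm X D := by
  obtain ⟨e, -, h, -, -, h'⟩ := exists_relative_eigenvalues hX hD
  rwa [h]

theorem hessianForm_smul (a : ℝ) : hessianForm X (a • D) = a ^ 2 * hessianForm X D := by
  simp only [hessianForm, Matrix.mul_smul, Matrix.smul_mul, smul_smul, trace_smul, smul_eq_mul]
  ring

/-- The symmetric bilinear form `tr(X⁻¹ D X⁻¹ E)` whose quadratic form is `hessianForm X`. -/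
noncomputable def hessianBilin (X D E : Matrix (Fin p) (Fin p) ℝ) : ℝ :=
  (X⁻¹ * D * X⁻¹ * E).trace

theorem hessianBilin_self : hessianBilin X D D = hessianForm X D := rfl

theorem hessianBilin_comm (D E : Matrix (Fin p) (Fin p) ℝ) :
    hessianBilin X D E = hessianBilin X E D := by
  rw [hessianBilin, hessianBilin, Matrix.mul_assoc, trace_mul_comm, ← Matrix.mul_assoc]

theorem hessianBilin_add_right (D E F : Matrix (Fin p) (Fin p) ℝ) :
    hessianBilin X D (E + F) = hessianBilin X D E + hessianBilin X D F := by
  simp [hessianBilin, Matrix.mul_add]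

theorem hessianBilin_sub_right (D E F : Matrix (Fin p) (Fin p) ℝ) :
    hessianBilin X D (E - F) = hessianBilin X D E - hessianBilin X D F := by
  simp [hessianBilin, Matrix.mul_sub]

theorem hessianForm_add_smul (D E : Matrix (Fin p) (Fin p) ℝ) (a : ℝ) :
    hessianForm X (D + a • E)
      = hessianForm X D + 2 * a * hessianBilin X D E + a ^ 2 * hessianForm X E := by
  have h := hessianBilin_comm (X := X) D E
  simp only [hessianBilin] at h
  simp only [hessianForm, hessianBilin, Matrix.mul_add, Matrix.add_mul, Matrix.mul_smul,
    Matrix.smul_mul, trace_add, trace_smul, smul_eq_mul]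
  rw [← h]
  ring

theorem abs_hessianBilin_le (D E : Matrix (Fin p) (Fin p) ℝ) :
    |hessianBilin X D E| ≤ ‖X⁻¹‖ ^ 2 * ‖D‖ * ‖E‖ := by
  refine (abs_trace_mul_le _ _).trans ?_
  gcongr
  calc ‖X⁻¹ * D * X⁻¹‖ ≤ ‖X⁻¹‖ * ‖D‖ * ‖X⁻¹‖ :=
        (norm_mul_le _ _).trans (by gcongr; exact norm_mul_le _ _)
    _ = _ := by ring

theorem hessianForm_le (D : Matrix (Fin p) (Fin p) ℝ) :
    hessianForm X D ≤ ‖X⁻¹‖ ^ 2 * ‖D‖ ^ 2 := by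
  have := (le_abs_self _).trans (abs_hessianBilin_le (X := X) D D)
  rw [hessianBilin_self] at this
  linarith

end LinearAlgebra

/-! ### Lower and upper models of the smooth part. -/

section SmoothPart

variable {p : ℕ} {S X D : Matrix (Fin p) (Fin p) ℝ}

/-- With s = √(1 + e), log(1 + e) = 2 log s ≤ 2(s - 1) = e - (s - 1)², while e² = (s - 1)²(s + 1)²
and (s + 1)² ≤ 2(s² + 1) = 4 + 2e. -/
theorem log_one_add_le {e R : ℝ} (he : 0 < 1 + e) (heR : e ≤ R) :
    Real.log (1 + e) ≤ e - e ^ 2 / (4 + 2 * R) := by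
  set s := √(1 + e) with hs
  have hs0 : 0 < s := Real.sqrt_pos.2 he
  have hss : s ^ 2 = 1 + e := Real.sq_sqrt he.le
  have hlog : Real.log (1 + e) ≤ 2 * (s - 1) := by
    rw [← hss, Real.log_pow]
    have := Real.log_le_sub_one_of_pos hs0
    push_cast
    linarith
  have hR : 0 < 4 + 2 * R := by linarith
  have hdiv : e ^ 2 / (4 + 2 * R) ≤ (s - 1) ^ 2 := by
    rw [div_le_iff₀ hR]
    have he' : e = (s - 1) * (s + 1) := by linarith [hss, (by ring : (s - 1) * (s + 1) = s ^ 2 - 1)]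
    rw [he', mul_pow]
    gcongr
    nlinarith [sq_nonneg (s - 1)]
  nlinarith

theorem sub_le_log_one_add {e : ℝ} (he : |e| ≤ 1 / 2) :
    e - e ^ 2 / 2 - 2 * |e| * e ^ 2 ≤ Real.log (1 + e) := by
  have h := Real.abs_log_sub_add_sum_range_le (x := -e) (by rw [abs_neg]; linarith) 2
  norm_num [Finset.sum_range_succ] at h
  have h1 : |e| ^ 3 / (1 - |e|) ≤ 2 * |e| ^ 3 := by
    rw [div_le_iff₀ (by linarith)]
    nlinarith [pow_nonneg (abs_nonneg e) 3]
  have h2 : |e| ^ 3 = |e| * e ^ 2 := by rw [pow_succ', sq_abs]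
  have h3 := (abs_le.1 (h.trans h1)).1
  rw [h2] at h3
  linarith

theorem trace_gradient_mul (hS : S.IsSymm) (hX : X.IsSymm) (D : Matrix (Fin p) (Fin p) ℝ) :
    ((gradient S X)ᵀ * D).trace = (S * D).trace - (X⁻¹ * D).trace := by
  rw [gradient, transpose_sub, hS.eq, (isSymm_inv hX).eq, Matrix.sub_mul, trace_sub]

theorem smoothPart_add_eq {e : Fin p → ℝ} (hS : S.IsSymm) (hX : X.PosDef)
    (htr : (X⁻¹ * D).trace = ∑ i, e i) (hdet : (X + D).det = X.det * ∏ i, (1 + e i))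
    (he : ∀ i, 0 < 1 + e i) :
    smoothPart S (X + D) = smoothPart S X + ((gradient S X)ᵀ * D).trace
      + ∑ i, (e i - Real.log (1 + e i)) := by
  rw [smoothPart, smoothPart, hdet, Real.log_mul hX.det_pos.ne'
    (Finset.prod_pos fun i _ => he i).ne', Real.log_prod fun i _ => (he i).ne', Matrix.mul_add,
    trace_add, trace_gradient_mul hS hX.isSymm, Finset.sum_sub_distrib, ← htr]
  ring

/-- Strong convexity of the smooth part, relative to the Hessian at the base point. -/
theorem le_smoothPart_add (hS : S.IsSymm) (hX : X.PosDef) (hD : D.IsSymm) (hXD : (X + D).PosDef)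
    {R : ℝ} (hR : 0 ≤ R) (hDR : hessianForm X D ≤ R ^ 2) :
    smoothPart S X + ((gradient S X)ᵀ * D).trace + hessianForm X D / (4 + 2 * R)
      ≤ smoothPart S (X + D) := by
  obtain ⟨e, htr, hH, hdet, hpd, -⟩ := exists_relative_eigenvalues hX hD
  have he := hpd.1 hXD
  rw [smoothPart_add_eq hS hX htr hdet he, hH, Finset.sum_div]
  gcongr with i
  have : e i ^ 2 ≤ R ^ 2 :=
    (Finset.single_le_sum (f := fun i => e i ^ 2) (fun i _ => sq_nonneg _)
      (Finset.mem_univ i)).trans (hH ▸ hDR)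
  linarith [log_one_add_le (he i) (le_of_sq_le_sq this hR)]

/-- Inside a local-norm ball, the smooth part is bounded by its quadratic Taylor polynomial up to
a cubic error. -/
theorem smoothPart_add_le (hS : S.IsSymm) (hX : X.PosDef) (hD : D.IsSymm)
    {N : ℝ} (hN : 0 ≤ N) (hN2 : N ≤ 1 / 2) (hDN : hessianForm X D ≤ N ^ 2) :
    (X + D).PosDef ∧ smoothPart S (X + D) ≤ smoothPart S X + ((gradient S X)ᵀ * D).trace
      + hessianForm X D / 2 + 2 * N * hessianForm X D := by
  obtain ⟨e, htr, hH, hdet, hpd, -⟩ := exists_relative_eigenvalues hX hD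
  have heN : ∀ i, |e i| ≤ N := fun i => abs_le_of_sq_le_sq
    ((Finset.single_le_sum (f := fun i => e i ^ 2) (fun i _ => sq_nonneg _)
      (Finset.mem_univ i)).trans (hH ▸ hDN)) hN
  have he : ∀ i, 0 < 1 + e i := fun i => by linarith [(abs_le.1 (heN i)).1]
  refine ⟨hpd.2 he, ?_⟩
  rw [smoothPart_add_eq hS hX htr hdet he, hH, Finset.sum_div, Finset.mul_sum, add_assoc _ (∑ i, _),
    ← Finset.sum_add_distrib]
  gcongr with i
  have h1 := sub_le_log_one_add ((heN i).trans hN2)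
  nlinarith [mul_le_mul_of_nonneg_right (heN i) (sq_nonneg (e i))]

end SmoothPart

/-! ### Convexity and Lipschitz bounds for the penalty. -/

section WeightedL1

variable {p : ℕ} {Λ : Matrix (Fin p) (Fin p) ℝ}

theorem weightedL1_nonneg (hΛ : ∀ i j, 0 ≤ Λ i j) (X : Matrix (Fin p) (Fin p) ℝ) :
    0 ≤ weightedL1 Λ X :=
  Finset.sum_nonneg fun i _ => Finset.sum_nonneg fun j _ => mul_nonneg (hΛ i j) (abs_nonneg _)

theorem weightedL1_add_smul_le (hΛ : ∀ i j, 0 ≤ Λ i j) (X E : Matrix (Fin p) (Fin p) ℝ) {a : ℝ}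
    (h0 : 0 ≤ a) (h1 : a ≤ 1) :
    weightedL1 Λ (X + a • E) ≤ weightedL1 Λ X + a * (weightedL1 Λ (X + E) - weightedL1 Λ X) := by
  simp only [weightedL1, ← Finset.sum_sub_distrib, Finset.mul_sum, ← Finset.sum_add_distrib]
  refine Finset.sum_le_sum fun i _ => Finset.sum_le_sum fun j _ => ?_
  have h : |(X + a • E) i j| ≤ (1 - a) * |X i j| + a * |(X + E) i j| := by
    have : (X + a • E) i j = (1 - a) * X i j + a * (X + E) i j := by simp; ring
    rw [this]
    refine (abs_add_le _ _).trans_eq ?_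
    rw [abs_mul, abs_mul, abs_of_nonneg h0, abs_of_nonneg (sub_nonneg.2 h1)]
  calc _ ≤ Λ i j * ((1 - a) * |X i j| + a * |(X + E) i j|) := by gcongr; exact hΛ i j
    _ = _ := by ring

theorem weightedL1_sub_le (hΛ : ∀ i j, 0 ≤ Λ i j) (X D : Matrix (Fin p) (Fin p) ℝ) :
    weightedL1 Λ X - weightedL1 Λ (X + D) ≤ ‖Λ‖ * ‖D‖ := by
  have h : weightedL1 Λ X - weightedL1 Λ (X + D) ≤ (Λᵀ * D.map abs).trace := by
    rw [trace_transpose_mul_eq_sum]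
    simp only [weightedL1, ← Finset.sum_sub_distrib]
    refine Finset.sum_le_sum fun i _ => Finset.sum_le_sum fun j _ => ?_
    rw [← mul_sub]
    refine mul_le_mul_of_nonneg_left ?_ (hΛ i j)
    have := abs_sub_abs_le_abs_sub (X i j) ((X + D) i j)
    simpa using this
  refine h.trans ((le_abs_self _).trans ((abs_trace_transpose_mul_le _ _).trans_eq ?_))
  rw [frobenius_norm_map_eq _ _ (by simp)]

theorem continuous_weightedL1 : Continuous (weightedL1 Λ) := by
  unfold weightedL1
  fun_prop

end WeightedL1

/-! ### The subspace of admissible directions. -/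

section SupportedDirections

variable {p : ℕ} {J : Set (Fin p × Fin p)} {D E : Matrix (Fin p) (Fin p) ℝ}

theorem zero_mem_supportedDirections : (0 : Matrix (Fin p) (Fin p) ℝ) ∈ supportedDirections J :=
  ⟨isSymm_zero, fun _ _ _ => rfl⟩

theorem add_smul_sub_mem_supportedDirections (hD : D ∈ supportedDirections J)
    (hE : E ∈ supportedDirections J) (a : ℝ) : D + a • (E - D) ∈ supportedDirections J :=
  ⟨hD.1.add ((hE.1.sub hD.1).smul a), fun i j h => by simp [hD.2 i j h, hE.2 i j h]⟩

theorem isClosed_supportedDirections : IsClosed (supportedDirections J) := by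
  have h : supportedDirections J = {D : Matrix (Fin p) (Fin p) ℝ | Dᵀ = D} ∩
      ⋂ i, ⋂ j, ⋂ (_ : (i, j) ∉ J), {D | D i j = 0} := by
    ext D
    simp [supportedDirections, IsSymm]
  rw [h]
  refine (isClosed_eq (by fun_prop) continuous_id).inter ?_
  exact isClosed_iInter fun i => isClosed_iInter fun j => isClosed_iInter fun _ =>
    isClosed_eq (by fun_prop) continuous_const

end SupportedDirections

/-! ### Newton directions: existence and first-order conditions. -/

section NewtonDirection

variable {p : ℕ} {S Λ X D E : Matrix (Fin p) (Fin p) ℝ} {J : Set (Fin p × Fin p)}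

theorem nonneg_of_forall_add_sq_nonneg {a b r : ℝ} (hr : 0 < r)
    (h : ∀ t, 0 < t → t ≤ r → 0 ≤ t * a + t ^ 2 * b) : 0 ≤ a := by
  have hev : ∀ᶠ t in 𝓝[>] (0 : ℝ), 0 ≤ a + t * b := by
    filter_upwards [Ioc_mem_nhdsGT hr] with t ht
    have := h t ht.1 ht.2
    exact nonneg_of_mul_nonneg_right (by linarith : 0 ≤ t * (a + t * b)) ht.1
  have hlim : Tendsto (fun t : ℝ => a + t * b) (𝓝[>] 0) (𝓝 (a + 0 * b)) :=
    (Continuous.tendsto (by fun_prop) 0).mono_left nhdsWithin_le_nhds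
  simpa using ge_of_tendsto hlim hev

/-- The variational inequality that characterises a Newton direction. -/
theorem IsNewtonDirection.variational (hΛ : ∀ i j, 0 ≤ Λ i j) (hD : IsNewtonDirection S Λ X J D)
    (hE : E ∈ supportedDirections J) :
    0 ≤ ((gradient S X)ᵀ * (E - D)).trace + hessianBilin X D (E - D)
      + (weightedL1 Λ (X + E) - weightedL1 Λ (X + D)) := by
  refine nonneg_of_forall_add_sq_nonneg (b := hessianForm X (E - D) / 2) one_pos
    fun t ht ht1 => ?_
  have h := hD.2 _ (add_smul_sub_mem_supportedDirections hD.1 hE t)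
  have hl := weightedL1_add_smul_le hΛ (X + D) (E - D) ht.le ht1
  rw [show X + D + (E - D) = X + E by abel, add_assoc] at hl
  simp only [quadraticModel, hessianForm_add_smul, Matrix.mul_add, Matrix.mul_smul, trace_add,
    trace_smul, smul_eq_mul] at h
  linarith

/-- The variational inequality tested with E = 0. It makes D a descent direction, with a quantified
decrease. -/
theorem IsNewtonDirection.predictedDecrease_le (hΛ : ∀ i j, 0 ≤ Λ i j)
    (hD : IsNewtonDirection S Λ X J D) :
    predictedDecrease S Λ X D ≤ -hessianForm X D := by
  have h := hD.variational hΛ zero_mem_supportedDirections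
  rw [hessianBilin_sub_right, hessianBilin_self, add_zero, Matrix.mul_sub, trace_sub,
    Matrix.mul_zero, trace_zero] at h
  have h0 : hessianBilin X D 0 = 0 := by simp [hessianBilin]
  rw [predictedDecrease]
  linarith

theorem exists_isNewtonDirection (hΛ : ∀ i j, 0 ≤ Λ i j) (hX : X.PosDef)
    (J : Set (Fin p × Fin p)) : ∃ D, IsNewtonDirection S Λ X J D := by
  have hcont : Continuous (quadraticModel S Λ X) := by
    unfold quadraticModel hessianForm
    have := continuous_weightedL1 (Λ := Λ)
    fun_prop
  set G := ‖gradient S X‖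
  set T := X.trace
  -- Quadratic growth of the model gives coercivity; T² + 1 replaces T², which vanishes when p = 0.
  have hlower : ∀ D ∈ supportedDirections J,
      -(G * ‖D‖) + ‖D‖ ^ 2 / (2 * (T ^ 2 + 1)) ≤ quadraticModel S Λ X D := by
    intro D hD
    have h1 := (abs_le.1 (abs_trace_transpose_mul_le (gradient S X) D)).1
    have h2 := weightedL1_nonneg hΛ (X + D)
    have h3 := norm_sq_le_hessianForm hX hD.1
    have h4 : ‖D‖ ^ 2 / (2 * (T ^ 2 + 1)) ≤ hessianForm X D / 2 := by
      rw [div_le_div_iff₀ (by positivity) two_pos]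
      nlinarith [hessianForm_nonneg hX hD.1]
    rw [quadraticModel]
    linarith
  have hcoer : Tendsto (fun x : ℝ => -(G * x) + x ^ 2 / (2 * (T ^ 2 + 1))) atTop atTop := by
    have h1 : Tendsto (fun x : ℝ => x * (x / (2 * (T ^ 2 + 1)) - G)) atTop atTop :=
      tendsto_id.atTop_mul_atTop₀
        (tendsto_atTop_add_const_right _ _ (tendsto_id.atTop_div_const (by positivity)))
    refine h1.congr fun x => ?_
    ring
  have hev : ∀ᶠ D in cocompact (Matrix (Fin p) (Fin p) ℝ) ⊓ 𝓟 (supportedDirections J),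
      quadraticModel S Λ X 0 ≤ quadraticModel S Λ X D := by
    rw [eventually_inf_principal]
    filter_upwards [(hcoer.comp (tendsto_norm_cocompact_atTop (E := Matrix (Fin p) (Fin p) ℝ))
      ).eventually_ge_atTop (quadraticModel S Λ X 0)] with D hD hDJ
    exact hD.trans (hlower D hDJ)
  obtain ⟨D, hD, hmin⟩ := hcont.continuousOn.exists_isMinOn' isClosed_supportedDirections
    zero_mem_supportedDirections hev
  exact ⟨D, hD, fun E hE => hmin hE⟩

end NewtonDirection

/-! ### Acceptance and lower bounds for Armijo steps. -/

section LineSearch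

variable {p : ℕ} {S Λ X D E : Matrix (Fin p) (Fin p) ℝ} {J : Set (Fin p × Fin p)} {σ β : ℝ}

theorem objective_add_smul_le (hS : S.IsSymm) (hΛ : ∀ i j, 0 ≤ Λ i j) (hX : X.PosDef)
    (hD : D.IsSymm) {N a : ℝ} (hN : 0 ≤ N) (hDN : hessianForm X D ≤ N ^ 2) (ha : 0 ≤ a)
    (ha1 : a ≤ 1) (haN : a * N ≤ 1 / 2) :
    (X + a • D).PosDef ∧ objective S Λ (X + a • D) ≤ objective S Λ X
      + a * predictedDecrease S Λ X D + (1 / 2 + 2 * (a * N)) * (a ^ 2 * hessianForm X D) := by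
  have hH : hessianForm X (a • D) ≤ (a * N) ^ 2 := by
    rw [hessianForm_smul, mul_pow]; gcongr
  obtain ⟨h1, h2⟩ := smoothPart_add_le hS hX (hD.smul a) (mul_nonneg ha hN) haN hH
  refine ⟨h1, ?_⟩
  have h3 := weightedL1_add_smul_le hΛ X D ha ha1
  rw [hessianForm_smul, Matrix.mul_smul, trace_smul, smul_eq_mul] at h2
  rw [objective, objective, predictedDecrease]
  linarith

/-- For aN ≤ 1/4 the second-order coefficient 1/2 + 2aN is at most 1, so the error is at most
a²(-δ), and a ≤ 1 - σ fits it into the Armijo slack a(1 - σ)(-δ). -/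
theorem lineSearchCondition_of_le (hS : S.IsSymm) (hΛ : ∀ i j, 0 ≤ Λ i j) (hX : X.PosDef)
    (hD : IsNewtonDirection S Λ X J D) {N a : ℝ} (hN : 0 ≤ N) (hDN : hessianForm X D ≤ N ^ 2)
    (ha : 0 ≤ a) (haN : a * N ≤ 1 / 4) (hσ : 0 < σ) (haσ : a ≤ 1 - σ) :
    LineSearchCondition S Λ σ X D a := by
  obtain ⟨h1, h2⟩ := objective_add_smul_le (Λ := Λ) hS hΛ hX hD.1.1 hN hDN ha (by linarith)
    (by linarith)
  refine ⟨h1, h2.trans ?_⟩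
  have hδ := hD.predictedDecrease_le hΛ
  have hH := hessianForm_nonneg hX hD.1.1
  have h3 : (1 / 2 + 2 * (a * N)) * (a ^ 2 * hessianForm X D)
      ≤ 1 * (a ^ 2 * hessianForm X D) := by
    gcongr
    linarith
  have h4 : a ^ 2 * hessianForm X D ≤ a * ((1 - σ) * -predictedDecrease S Λ X D) := by
    rw [sq, mul_assoc]
    gcongr
    · linarith
    · linarith
  linarith

/-- The unit step is accepted once the Newton direction is short. -/
theorem lineSearchCondition_one (hS : S.IsSymm) (hΛ : ∀ i j, 0 ≤ Λ i j) (hX : X.PosDef)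
    (hD : IsNewtonDirection S Λ X J D) {N : ℝ} (hN : 0 ≤ N) (hDN : hessianForm X D ≤ N ^ 2)
    (hσ : 0 < σ) (hσN : 2 * N ≤ 1 / 2 - σ) :
    LineSearchCondition S Λ σ X D 1 := by
  obtain ⟨h1, h2⟩ := objective_add_smul_le (Λ := Λ) hS hΛ hX hD.1.1 hN hDN zero_le_one le_rfl
    (by linarith)
  refine ⟨h1, h2.trans ?_⟩
  have hδ := hD.predictedDecrease_le hΛ
  have hH := hessianForm_nonneg hX hD.1.1
  -- Here σ < 1/2 matters: 1/2 + 2N ≤ 1 - σ leaves room for the cubic error.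
  have h3 : (1 / 2 + 2 * (1 * N)) * (1 ^ 2 * hessianForm X D) ≤ (1 - σ) * hessianForm X D := by
    rw [one_pow, one_mul, one_mul]
    gcongr
    linarith
  nlinarith

theorem exists_isArmijoStep (hS : S.IsSymm) (hΛ : ∀ i j, 0 ≤ Λ i j) (hX : X.PosDef)
    (hD : IsNewtonDirection S Λ X J D) (hσ : 0 < σ ∧ σ < 1 / 2) (hβ : 0 < β ∧ β < 1) :
    ∃ a, IsArmijoStep S Λ σ β X D a := by
  have hex : ∃ k : ℕ, LineSearchCondition S Λ σ X D (β ^ k) := by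
    set N := √(hessianForm X D)
    have hN : hessianForm X D ≤ N ^ 2 := (Real.sq_sqrt (hessianForm_nonneg hX hD.1.1)).ge
    obtain ⟨k, hk⟩ := exists_pow_lt_of_lt_one (show 0 < 1 / (4 * (N + 1)) by positivity) hβ.2
    have hk' : β ^ k * (4 * (N + 1)) < 1 := (lt_div_iff₀ (by positivity)).1 hk
    have hβk : 0 < β ^ k := pow_pos hβ.1 k
    have hN0 : 0 ≤ N := Real.sqrt_nonneg _
    have := mul_nonneg hβk.le hN0
    exact ⟨k, lineSearchCondition_of_le hS hΛ hX hD hN0 hN hβk.le (by linarith) hσ.1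
      (by linarith)⟩
  classical
  exact ⟨_, Nat.find hex, rfl, Nat.find_spec hex, fun l hl => Nat.find_min hex hl⟩

theorem IsArmijoStep.eq_one {a : ℝ} (h : IsArmijoStep S Λ σ β X D a)
    (h1 : LineSearchCondition S Λ σ X D 1) : a = 1 := by
  obtain ⟨k, rfl, -, hk⟩ := h
  rcases Nat.eq_zero_or_pos k with rfl | hpos
  · exact pow_zero β
  · exact absurd (by simpa using h1) (hk 0 hpos)

/-- Armijo steps are bounded below in terms of the length of the Newton direction. -/
theorem IsArmijoStep.le (hS : S.IsSymm) (hΛ : ∀ i j, 0 ≤ Λ i j) (hX : X.PosDef)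
    (hD : IsNewtonDirection S Λ X J D) (hσ : 0 < σ ∧ σ < 1 / 2) (hβ : 0 < β ∧ β < 1)
    {N a : ℝ} (hN : 0 ≤ N) (hDN : hessianForm X D ≤ N ^ 2)
    (h : IsArmijoStep S Λ σ β X D a) : β / (4 * (N + 1)) ≤ a := by
  obtain ⟨k, rfl, -, hk⟩ := h
  rcases Nat.eq_zero_or_pos k with rfl | hpos
  · rw [pow_zero, div_le_one (by positivity)]
    linarith
  · obtain ⟨l, rfl⟩ : ∃ l, k = l + 1 := ⟨k - 1, by omega⟩
    rw [pow_succ, div_le_iff₀ (by positivity)]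
    by_contra! hlt
    have hβl : 0 < β ^ l := pow_pos hβ.1 l
    have hlt' : β ^ l * (4 * (N + 1)) < 1 := by
      refine lt_of_mul_lt_mul_right ?_ hβ.1.le
      linarith
    have := mul_nonneg hβl.le hN
    exact hk l l.lt_succ_self (lineSearchCondition_of_le hS hΛ hX hD hN hDN hβl.le (by linarith)
      hσ.1 (by linarith))

end LineSearch

/-! ### First-order optimality and uniqueness of the minimizer. -/

section Optimality

variable {p : ℕ} {S Λ X Y D E : Matrix (Fin p) (Fin p) ℝ}

theorem IsMinimizer.variational (hS : S.IsSymm) (hΛ : ∀ i j, 0 ≤ Λ i j) (hX : IsMinimizer S Λ X)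
    (hE : E.IsSymm) :
    0 ≤ predictedDecrease S Λ X E := by
  set N := √(hessianForm X E)
  have hN : hessianForm X E ≤ N ^ 2 := (Real.sq_sqrt (hessianForm_nonneg hX.1 hE)).ge
  have hN0 : 0 ≤ N := Real.sqrt_nonneg _
  refine nonneg_of_forall_add_sq_nonneg (b := 3 / 2 * hessianForm X E)
    (r := 1 / (2 * (N + 1))) (by positivity) fun t ht htr => ?_
  have htN : t * (2 * (N + 1)) ≤ 1 := (le_div_iff₀ (by positivity)).1 htr
  have := mul_nonneg ht.le hN0
  obtain ⟨h1, h2⟩ := objective_add_smul_le (Λ := Λ) hS hΛ hX.1 hE hN0 hN ht.le (by linarith)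
    (by linarith)
  have h3 := hX.2 _ h1
  have h4 : (1 / 2 + 2 * (t * N)) * (t ^ 2 * hessianForm X E)
      ≤ 3 / 2 * (t ^ 2 * hessianForm X E) := by
    have := hessianForm_nonneg hX.1 hE
    gcongr
    linarith
  linarith

theorem IsMinimizer.unique (hS : S.IsSymm) (hΛ : ∀ i j, 0 ≤ Λ i j) (hX : IsMinimizer S Λ X)
    (hY : IsMinimizer S Λ Y) : Y = X := by
  have hE : (Y - X).IsSymm := hY.1.isSymm.sub hX.1.isSymm
  have hXY : X + (Y - X) = Y := by abel
  have h1 := hX.variational hS hΛ hE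
  have hN := (Real.sq_sqrt (hessianForm_nonneg hX.1 hE)).ge
  have h2 := le_smoothPart_add hS hX.1 hE (by rw [hXY]; exact hY.1) (Real.sqrt_nonneg _) hN
  have h3 := hY.2 _ hX.1
  rw [predictedDecrease] at h1
  rw [objective, objective] at h3
  rw [hXY] at h1 h2
  set R := √(hessianForm X (Y - X))
  have hR : 0 ≤ R := Real.sqrt_nonneg _
  have h4 : hessianForm X (Y - X) / (4 + 2 * R) ≤ 0 := by linarith
  rw [div_le_iff₀ (by positivity), zero_mul] at h4
  have h5 := norm_sq_le_hessianForm hX.1 hE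
  have h6 : ‖Y - X‖ ^ 2 ≤ 0 := h5.trans (mul_nonpos_of_nonneg_of_nonpos (sq_nonneg _) h4)
  have h7 : ‖Y - X‖ = 0 := pow_eq_zero_iff two_ne_zero |>.1 (le_antisymm h6 (sq_nonneg _))
  exact sub_eq_zero.1 (norm_eq_zero.1 h7)

end Optimality

/-! ### Compact sublevel sets and existence of the minimizer. -/

section Existence

variable {p : ℕ} {S Λ X : Matrix (Fin p) (Fin p) ℝ}

theorem exists_pos_forall_le {ι : Type*} [Finite ι] {a : ι → ℝ} (ha : ∀ i, 0 < a i) :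
    ∃ c, 0 < c ∧ ∀ i, c ≤ a i := by
  cases isEmpty_or_nonempty ι
  · exact ⟨1, one_pos, fun i => isEmptyElim i⟩
  · obtain ⟨i, hi⟩ := Finite.exists_min a
    exact ⟨a i, ha i, hi⟩

theorem trace_mul_nonneg (hS : S.PosSemidef) (hX : X.PosDef) : 0 ≤ (S * X).trace := by
  obtain ⟨C, -, -, h, -⟩ := exists_congruence (D := 0) hX isSymm_zero
  have := (hS.mul_mul_conjTranspose_same C).trace_nonneg
  rwa [conjTranspose_eq_transpose_of_trivial, Matrix.mul_assoc, trace_mul_comm, Matrix.mul_assoc,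
    ← h] at this

theorem mul_trace_le_of_diag_le {c : ℝ} {a : Fin p → ℝ} (ha : ∀ i, c ≤ a i) (hX : X.PosDef) :
    c * X.trace ≤ ∑ i, a i * X i i := by
  rw [trace, Finset.mul_sum]
  exact Finset.sum_le_sum fun i _ => mul_le_mul_of_nonneg_right (ha i) hX.diag_pos.le

/-- Under either regularity assumption, the linear and the `ℓ₁` terms together control the
trace. -/
theorem exists_mul_trace_le (hS : S.PosSemidef) (hΛ : ∀ i j, 0 ≤ Λ i j)
    (hreg : ((∀ i j, i ≠ j → 0 < Λ i j) ∧ (∀ i, 0 < S i i)) ∨ (∀ i, 0 < Λ i i)) :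
    ∃ c, 0 < c ∧ ∀ X : Matrix (Fin p) (Fin p) ℝ, X.PosDef →
      c * X.trace ≤ (S * X).trace + weightedL1 Λ X := by
  rcases hreg with ⟨hoff, hdiag⟩ | hdiag
  · obtain ⟨s, hs, hsle⟩ := exists_pos_forall_le hdiag
    obtain ⟨ε₀, hε₀, hle⟩ := exists_pos_forall_le
      (a := fun ij : {ij : Fin p × Fin p // ij.1 ≠ ij.2} =>
        Λ ij.1.1 ij.1.2 / (|S ij.1.1 ij.1.2| + 1))
      (fun ij => div_pos (hoff _ _ ij.2) (by positivity))
    -- Scaling S by ε lets the off-diagonal penalty absorb the off-diagonal part of tr(SX). The cap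
    -- ε ≤ 1 gives ε tr(SX) ≤ tr(SX), since tr(SX) ≥ 0.
    set ε := min ε₀ 1
    have hε : 0 < ε := lt_min hε₀ one_pos
    have hεS : ∀ i j, i ≠ j → ε * |S i j| ≤ Λ i j := fun i j hij => by
      have h := (le_div_iff₀ (by positivity)).1 (hle ⟨(i, j), hij⟩)
      have h' : ε * |S i j| ≤ ε₀ * |S i j| := by gcongr; exact min_le_left _ _
      simp only at h
      linarith
    refine ⟨ε * s, mul_pos hε hs, fun X hX => ?_⟩
    have h1 : ε * (S * X).trace ≤ (S * X).trace :=
      mul_le_of_le_one_left (trace_mul_nonneg hS hX) (min_le_right _ _)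
    have hSsymm : Sᵀ = S := by
      rw [← conjTranspose_eq_transpose_of_trivial]; exact hS.isHermitian
    have h2 : (S * X).trace = ∑ i, ∑ j, S i j * X i j := by
      rw [← trace_transpose_mul_eq_sum, hSsymm]
    have h3 : ∑ i, ε * S i i * X i i ≤ ε * (S * X).trace + weightedL1 Λ X := by
      rw [h2, weightedL1, Finset.mul_sum, ← Finset.sum_add_distrib]
      simp only [Finset.mul_sum, ← Finset.sum_add_distrib]
      refine Finset.sum_le_sum fun i _ => ?_
      have hterm : ∀ j ≠ i, 0 ≤ ε * (S i j * X i j) + Λ i j * |X i j| := fun j hij => by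
        have h4 := mul_le_mul_of_nonneg_right (hεS i j hij.symm) (abs_nonneg (X i j))
        have h5 := neg_abs_le (S i j * X i j)
        rw [abs_mul] at h5
        nlinarith
      rw [← Finset.add_sum_erase _ _ (Finset.mem_univ i)]
      have h6 := Finset.sum_nonneg (s := Finset.univ.erase i) fun j hj =>
        hterm j (Finset.ne_of_mem_erase hj)
      have h7 := mul_nonneg (hΛ i i) (abs_nonneg (X i i))
      linarith
    have h8 := mul_trace_le_of_diag_le (c := ε * s) (a := fun i => ε * S i i)
      (fun i => by gcongr; exact hsle i) hX
    linarith
  · obtain ⟨c, hc, hle⟩ := exists_pos_forall_le hdiag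
    refine ⟨c, hc, fun X hX => ?_⟩
    have h1 := mul_trace_le_of_diag_le hle hX
    have h2 : ∑ i, Λ i i * X i i ≤ weightedL1 Λ X := by
      refine Finset.sum_le_sum fun i _ => ?_
      refine le_trans ?_ (Finset.single_le_sum (f := fun j => Λ i j * |X i j|)
        (fun j _ => mul_nonneg (hΛ i j) (abs_nonneg _)) (Finset.mem_univ i))
      exact mul_le_mul_of_nonneg_left (le_abs_self _) (hΛ i i)
    linarith [trace_mul_nonneg hS hX]

/-- Relative to the identity, the numbers 1 + eᵢ are the eigenvalues of X; apply log x ≤ x - 1 to x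
= c(1 + eᵢ) and sum. -/
theorem log_det_le (hX : X.PosDef) {c : ℝ} (hc : 0 < c) :
    Real.log X.det ≤ c * X.trace - p * (1 + Real.log c) := by
  obtain ⟨e, htr, -, hdet, hpd, -⟩ := exists_relative_eigenvalues
    (X := (1 : Matrix (Fin p) (Fin p) ℝ)) (D := X - 1) PosDef.one (hX.isSymm.sub isSymm_one)
  rw [add_sub_cancel] at hdet hpd
  have he := hpd.1 hX
  have htr' : X.trace = ∑ i, (1 + e i) := by
    rw [inv_one, Matrix.one_mul, trace_sub, trace_one] at htr
    simp only [Finset.sum_add_distrib, Finset.sum_const, Finset.card_univ, nsmul_eq_mul, mul_one]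
    linarith
  have hterm : ∀ i, Real.log (1 + e i) ≤ c * (1 + e i) - (1 + Real.log c) := fun i => by
    have := Real.log_le_sub_one_of_pos (mul_pos hc (he i))
    rw [Real.log_mul hc.ne' (he i).ne'] at this
    linarith
  rw [hdet, det_one, one_mul, Real.log_prod fun i _ => (he i).ne', htr', Finset.mul_sum]
  refine (Finset.sum_le_sum fun i _ => hterm i).trans_eq ?_
  simp only [Finset.sum_sub_distrib, Finset.sum_const, Finset.card_univ, Fintype.card_fin,
    nsmul_eq_mul]

/-- The positive semidefinite matrices with bounded trace and determinant bounded away from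
zero. -/
def spectralBox (p : ℕ) (T d : ℝ) : Set (Matrix (Fin p) (Fin p) ℝ) :=
  {X | X.PosSemidef ∧ X.trace ≤ T ∧ d ≤ X.det}

theorem posDef_of_mem_spectralBox {T d : ℝ} (hd : 0 < d) (hX : X ∈ spectralBox p T d) :
    X.PosDef :=
  hX.1.posDef_iff_det_ne_zero.2 (hd.trans_le hX.2.2).ne'

/-- Semidefiniteness and d ≤ det X are closed conditions that together force definiteness; the trace
bounds the norm. -/
theorem isCompact_spectralBox {T d : ℝ} (hd : 0 < d) : IsCompact (spectralBox p T d) := by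
  refine Metric.isCompact_of_isClosed_isBounded ?_ ?_
  · have h : spectralBox p T d = ({X | Xᴴ = X} ∩ ⋂ v : Fin p → ℝ, {X | 0 ≤ star v ⬝ᵥ (X *ᵥ v)}) ∩
        ({X | X.trace ≤ T} ∩ {X | d ≤ X.det}) := by
      ext X
      simp [spectralBox, posSemidef_iff_dotProduct_mulVec, IsHermitian]
    rw [h]
    refine ((isClosed_eq (by fun_prop) continuous_id).inter (isClosed_iInter fun v =>
      isClosed_le continuous_const (by fun_prop))).inter
      ((isClosed_le (by fun_prop) continuous_const).inter
        (isClosed_le continuous_const (by fun_prop)))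
  · refine isBounded_iff_forall_norm_le.2 ⟨T, fun X hX => ?_⟩
    exact (norm_le_trace (posDef_of_mem_spectralBox hd hX)).trans hX.2.1

/-- Sublevel sets of the objective lie in a spectral box. -/
theorem exists_sublevel_subset_spectralBox (hS : S.PosSemidef) (hΛ : ∀ i j, 0 ≤ Λ i j)
    (hreg : ((∀ i j, i ≠ j → 0 < Λ i j) ∧ (∀ i, 0 < S i i)) ∨ (∀ i, 0 < Λ i i)) (K : ℝ) :
    ∃ T d, 0 < d ∧ ∀ X : Matrix (Fin p) (Fin p) ℝ, X.PosDef → objective S Λ X ≤ K →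
      X ∈ spectralBox p T d := by
  obtain ⟨c, hc, hle⟩ := exists_mul_trace_le hS hΛ hreg
  -- Half of the trace term is spent on log det and the other half bounds the trace. The remaining
  -- terms of f are nonnegative, so -log det X ≤ K.
  refine ⟨(K - p * (1 + Real.log (c / 2))) / (c / 2), Real.exp (-K), Real.exp_pos _,
    fun X hX hK => ⟨hX.posSemidef, ?_, ?_⟩⟩
  · rw [le_div_iff₀ (by positivity)]
    have h1 := hle X hX
    have h2 := log_det_le hX (half_pos hc)
    rw [objective, smoothPart] at hK
    linarith
  · rw [← Real.le_log_iff_exp_le hX.det_pos]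
    have h1 := hle X hX
    have h2 := mul_nonneg hc.le hX.posSemidef.trace_nonneg
    rw [objective, smoothPart] at hK
    linarith

theorem exists_norm_inv_le {T d : ℝ} (hd : 0 < d) :
    ∃ V, ∀ X ∈ spectralBox p T d, ‖X⁻¹‖ ≤ V := by
  refine (isCompact_spectralBox hd).exists_bound_of_continuousOn ?_
  have h : (Inv.inv : Matrix (Fin p) (Fin p) ℝ → _) = fun X => (X.det)⁻¹ • X.adjugate := by
    ext1 X
    rw [inv_def, Ring.inverse_eq_inv']
  rw [h]
  have hdet : ContinuousOn (fun X : Matrix (Fin p) (Fin p) ℝ => X.det) (spectralBox p T d) := by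
    fun_prop
  have hadj : ContinuousOn (fun X : Matrix (Fin p) (Fin p) ℝ => X.adjugate) (spectralBox p T d) :=
    continuous_id.matrix_adjugate.continuousOn
  exact (hdet.inv₀ fun X hX => (hd.trans_le hX.2.2).ne').smul hadj

theorem exists_isMinimizer (hS : S.PosSemidef) (hΛ : ∀ i j, 0 ≤ Λ i j)
    (hreg : ((∀ i j, i ≠ j → 0 < Λ i j) ∧ (∀ i, 0 < S i i)) ∨ (∀ i, 0 < Λ i i)) :
    ∃ X, IsMinimizer S Λ X := by
  obtain ⟨T, d, hd, hsub⟩ := exists_sublevel_subset_spectralBox hS hΛ hreg (objective S Λ 1)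
  have hcont : ContinuousOn (objective S Λ) (spectralBox p T d) := by
    unfold objective smoothPart
    refine ContinuousOn.add (ContinuousOn.add (ContinuousOn.neg ?_) (by fun_prop))
      continuous_weightedL1.continuousOn
    exact ContinuousOn.log (by fun_prop) fun X hX => (hd.trans_le hX.2.2).ne'
  have h1 := hsub 1 PosDef.one le_rfl
  obtain ⟨X, hX, hmin⟩ := (isCompact_spectralBox hd).exists_isMinOn ⟨1, h1⟩ hcont
  refine ⟨X, posDef_of_mem_spectralBox hd hX, fun Y hY => ?_⟩
  rcases le_total (objective S Λ Y) (objective S Λ 1) with h | h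
  · exact hmin (hsub Y hY h)
  · exact (hmin h1).trans h

end Existence

/-! ### Distance to the minimizer, and the local Newton estimate. -/

section ErrorBounds

variable {p : ℕ} {S Λ X Y D : Matrix (Fin p) (Fin p) ℝ} {J : Set (Fin p × Fin p)}

/-- `J` is a free set at `X`: it is symmetric, and outside it the entries of `X` vanish and are
stationary. Both rules of the algorithm select such sets. -/
structure IsFreeSet (S Λ X : Matrix (Fin p) (Fin p) ℝ) (J : Set (Fin p × Fin p)) : Prop where
  symm : ∀ i j, (i, j) ∈ J → (j, i) ∈ J
  abs_gradient_le : ∀ i j, (i, j) ∉ J → |gradient S X i j| ≤ Λ i j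
  eq_zero : ∀ i j, (i, j) ∉ J → X i j = 0

theorem isFreeSet_compl (hS : S.IsSymm) (hΛ : Λ.IsSymm) (hX : X.IsSymm)
    {fixed : Matrix (Fin p) (Fin p) ℝ → Set (Fin p × Fin p)}
    (hfixed : fixed = fixedSet S Λ ∨ fixed = strictFixedSet S Λ) :
    IsFreeSet S Λ X (fixed X)ᶜ := by
  have hG : (gradient S X).IsSymm := hS.sub (isSymm_inv hX)
  rcases hfixed with rfl | rfl
  · refine ⟨fun i j h h' => h ?_, fun i j h => ?_, fun i j h => ?_⟩
    · change |gradient S X j i| ≤ Λ j i ∧ X j i = 0 at h'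
      rwa [hG.apply, hΛ.apply, hX.apply] at h'
    · exact (not_not.1 h).1
    · exact (not_not.1 h).2
  · refine ⟨fun i j h h' => h ?_, fun i j h => ?_, fun i j h => ?_⟩
    · change |gradient S X j i| < Λ j i ∧ X j i = 0 at h'
      rwa [hG.apply, hΛ.apply, hX.apply] at h'
    · exact (not_not.1 h).1.le
    · exact (not_not.1 h).2

open Classical in
/-- The restriction of a matrix to the entries in `J`. -/
noncomputable def restrictTo (J : Set (Fin p × Fin p)) (E : Matrix (Fin p) (Fin p) ℝ) :
    Matrix (Fin p) (Fin p) ℝ :=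
  Matrix.of fun i j => if (i, j) ∈ J then E i j else 0

theorem restrictTo_apply_of_mem (E : Matrix (Fin p) (Fin p) ℝ) {i j : Fin p} (h : (i, j) ∈ J) :
    restrictTo J E i j = E i j := by simp [restrictTo, h]

theorem restrictTo_apply_of_notMem (E : Matrix (Fin p) (Fin p) ℝ) {i j : Fin p}
    (h : (i, j) ∉ J) : restrictTo J E i j = 0 := by simp [restrictTo, h]

theorem restrictTo_mem_supportedDirections (hJ : ∀ i j, (i, j) ∈ J → (j, i) ∈ J)
    {E : Matrix (Fin p) (Fin p) ℝ} (hE : E.IsSymm) : restrictTo J E ∈ supportedDirections J := by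
  refine ⟨IsSymm.ext fun i j => ?_, fun i j h => restrictTo_apply_of_notMem E h⟩
  by_cases h : (i, j) ∈ J
  · rw [restrictTo_apply_of_mem E h, restrictTo_apply_of_mem E (hJ i j h), hE.apply]
  · rw [restrictTo_apply_of_notMem E h, restrictTo_apply_of_notMem E fun h' => h (hJ j i h')]

theorem norm_restrictTo_le (E : Matrix (Fin p) (Fin p) ℝ) : ‖restrictTo J E‖ ≤ ‖E‖ := by
  refine le_of_sq_le_sq ?_ (norm_nonneg _)
  rw [norm_sq_eq_sum, norm_sq_eq_sum]
  refine Finset.sum_le_sum fun i _ => Finset.sum_le_sum fun j _ => ?_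
  by_cases h : (i, j) ∈ J
  · rw [restrictTo_apply_of_mem E h]
  · rw [restrictTo_apply_of_notMem E h, zero_pow two_ne_zero]; positivity

/-- Dropping the entries outside a free set does not increase the linearised objective. -/
theorem IsFreeSet.predictedDecrease_restrictTo_le (hJ : IsFreeSet S Λ X J)
    (E : Matrix (Fin p) (Fin p) ℝ) :
    predictedDecrease S Λ X (restrictTo J E) ≤ predictedDecrease S Λ X E := by
  rw [predictedDecrease, predictedDecrease, trace_transpose_mul_eq_sum, trace_transpose_mul_eq_sum]
  refine sub_le_sub_right ?_ _
  simp only [weightedL1, ← Finset.sum_add_distrib]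
  refine Finset.sum_le_sum fun i _ => Finset.sum_le_sum fun j _ => ?_
  by_cases h : (i, j) ∈ J
  · rw [Matrix.add_apply, Matrix.add_apply, restrictTo_apply_of_mem E h]
  · rw [Matrix.add_apply, Matrix.add_apply, restrictTo_apply_of_notMem E h, hJ.eq_zero i j h]
    have h1 := neg_abs_le (gradient S X i j * E i j)
    have h2 := mul_le_mul_of_nonneg_right (hJ.abs_gradient_le i j h) (abs_nonneg (E i j))
    rw [abs_mul] at h1
    simp only [mul_zero, add_zero, abs_zero, zero_add]
    linarith

/-- Distance to the minimizer in terms of the Newton direction. -/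
theorem hessianForm_sub_le (hS : S.IsSymm) (hΛ : ∀ i j, 0 ≤ Λ i j) (hX : X.PosDef)
    (hJ : IsFreeSet S Λ X J) (hD : IsNewtonDirection S Λ X J D) (hY : IsMinimizer S Λ Y)
    {R : ℝ} (hR : 0 ≤ R) (hYR : hessianForm X (Y - X) ≤ R ^ 2) :
    hessianForm X (Y - X) / (4 + 2 * R)
      ≤ -predictedDecrease S Λ X D + ‖X⁻¹‖ ^ 2 * ‖D‖ * (‖Y - X‖ + ‖D‖) := by
  have hE : (Y - X).IsSymm := hY.1.isSymm.sub hX.isSymm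
  have hXY : X + (Y - X) = Y := by abel
  -- Y - X itself need not be admissible, so the inequality is tested with its restriction to J, and
  -- the next line removes the restriction.
  have h1 := hD.variational hΛ (restrictTo_mem_supportedDirections hJ.symm hE)
  have h2 := hJ.predictedDecrease_restrictTo_le (Y - X)
  have h3 := le_smoothPart_add hS hX hE (by rw [hXY]; exact hY.1) hR hYR
  have h4 := hY.2 _ hX
  have h5 : hessianBilin X D (restrictTo J (Y - X) - D)
      ≤ ‖X⁻¹‖ ^ 2 * ‖D‖ * (‖Y - X‖ + ‖D‖) := by
    refine (le_abs_self _).trans ((abs_hessianBilin_le _ _).trans ?_)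
    gcongr
    exact (norm_sub_le _ _).trans (by gcongr; exact norm_restrictTo_le _)
  rw [Matrix.mul_sub, trace_sub] at h1
  rw [predictedDecrease, predictedDecrease] at h2
  rw [objective, objective] at h4
  rw [hXY] at h2 h3
  rw [predictedDecrease]
  linarith

/-- The remainder of the first-order expansion of the inverse. -/
theorem inv_sub_inv_sub_mul (hX : X.PosDef) (hY : Y.PosDef) :
    X⁻¹ - Y⁻¹ - X⁻¹ * (Y - X) * X⁻¹ = -(X⁻¹ * (Y - X) * X⁻¹ * (Y - X) * Y⁻¹) := by
  have h1 : X⁻¹ * X = 1 := nonsing_inv_mul X hX.det_pos.ne'.isUnit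
  have h2 : Y * Y⁻¹ = 1 := mul_nonsing_inv Y hY.det_pos.ne'.isUnit
  have h3 : X⁻¹ * (Y - X) * Y⁻¹ = X⁻¹ - Y⁻¹ := by
    rw [Matrix.mul_sub, Matrix.sub_mul, h1, Matrix.mul_assoc, h2, Matrix.mul_one, Matrix.one_mul]
  have h4 : X⁻¹ * (Y - X) * X⁻¹ * (Y - X) * Y⁻¹ = X⁻¹ * (Y - X) * (X⁻¹ * (Y - X) * Y⁻¹) := by
    simp only [Matrix.mul_assoc]
  have h5 : X⁻¹ * (Y - X) * (X⁻¹ - Y⁻¹) = X⁻¹ * (Y - X) * X⁻¹ - (X⁻¹ - Y⁻¹) := by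
    rw [Matrix.mul_sub _ X⁻¹ Y⁻¹, h3]
  rw [h4, h3, h5]
  abel

/-- A unit Newton step from a point whose free set sees all of `Y - X` squares the error. -/
theorem norm_newton_step_sub_le (hS : S.IsSymm) (hΛ : ∀ i j, 0 ≤ Λ i j) (hX : X.PosDef)
    (hD : IsNewtonDirection S Λ X J D) (hY : IsMinimizer S Λ Y)
    (hYX : Y - X ∈ supportedDirections J) :
    ‖X + D - Y‖ ≤ X.trace ^ 2 * (‖X⁻¹‖ ^ 2 * ‖Y⁻¹‖) * ‖X - Y‖ ^ 2 := by
  set Z := X + D - Y with hZ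
  have hZs : Z.IsSymm := (hX.isSymm.add hD.1.1).sub hY.1.isSymm
  -- D is tested against Y - X and Y against Z, so the ℓ₁ differences in the two inequalities are
  -- opposite and cancel on addition.
  have h1 := hD.variational hΛ hYX
  have h2 := hY.variational hS hΛ hZs
  have hn : Y - X - D = -Z := by rw [hZ]; abel
  have hDZ : D = (Y - X) + Z := by rw [hZ]; abel
  rw [hn, hessianBilin_comm] at h1
  rw [predictedDecrease, show Y + Z = X + D by rw [hZ]; abel] at h2
  rw [show X + (Y - X) = Y by abel] at h1
  have h3 : hessianBilin X (-Z) D = -hessianBilin X (Y - X) Z - hessianForm X Z := by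
    rw [hDZ, hessianBilin_add_right, hessianBilin_comm (-Z)]
    simp [hessianBilin, hessianForm]
    ring
  rw [h3, Matrix.mul_neg, trace_neg, trace_gradient_mul hS hX.isSymm] at h1
  rw [trace_gradient_mul hS hY.1.isSymm] at h2
  have h4 : hessianForm X Z ≤ ((X⁻¹ - Y⁻¹ - X⁻¹ * (Y - X) * X⁻¹) * Z).trace := by
    rw [Matrix.sub_mul, Matrix.sub_mul, trace_sub, trace_sub]
    rw [hessianBilin] at h1
    linarith
  rw [inv_sub_inv_sub_mul hX hY.1] at h4
  have h5 : hessianForm X Z ≤ ‖X⁻¹‖ ^ 2 * ‖Y⁻¹‖ * ‖X - Y‖ ^ 2 * ‖Z‖ := by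
    refine h4.trans ((le_abs_self _).trans ((abs_trace_mul_le _ _).trans ?_))
    gcongr
    rw [norm_neg, norm_sub_rev X Y]
    calc ‖X⁻¹ * (Y - X) * X⁻¹ * (Y - X) * Y⁻¹‖
        ≤ ‖X⁻¹‖ * ‖Y - X‖ * ‖X⁻¹‖ * ‖Y - X‖ * ‖Y⁻¹‖ := by
          refine (norm_mul_le _ _).trans ?_
          gcongr
          refine (norm_mul_le _ _).trans ?_
          gcongr
          refine (norm_mul_le _ _).trans ?_
          gcongr
          exact norm_mul_le _ _
      _ = _ := by ring
  have h6 := norm_sq_le_hessianForm hX hZs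
  have h7 : ‖Z‖ * ‖Z‖ ≤ (X.trace ^ 2 * (‖X⁻¹‖ ^ 2 * ‖Y⁻¹‖) * ‖X - Y‖ ^ 2) * ‖Z‖ := by
    have := mul_le_mul_of_nonneg_left h5 (sq_nonneg X.trace)
    linarith
  rcases (norm_nonneg Z).eq_or_lt with h0 | h0
  · rw [← h0]; positivity
  · exact le_of_mul_le_mul_right h7 h0

end ErrorBounds

/-! ### Well-definedness, global convergence and the quadratic rate. -/

section Convergence

variable {p : ℕ} {S Λ : Matrix (Fin p) (Fin p) ℝ} {σ β : ℝ}
  {fixed : Matrix (Fin p) (Fin p) ℝ → Set (Fin p × Fin p)} {X₀ : Matrix (Fin p) (Fin p) ℝ}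

theorem IsArmijoStep.lineSearchCondition {X D : Matrix (Fin p) (Fin p) ℝ} {a : ℝ}
    (h : IsArmijoStep S Λ σ β X D a) : LineSearchCondition S Λ σ X D a := by
  obtain ⟨k, rfl, hk, -⟩ := h
  exact hk

/-- The algorithm does not break down. -/
theorem exists_isQUICSequence (hS : S.IsSymm) (hΛ : ∀ i j, 0 ≤ Λ i j)
    (hσ : 0 < σ ∧ σ < 1 / 2) (hβ : 0 < β ∧ β < 1)
    (fixed : Matrix (Fin p) (Fin p) ℝ → Set (Fin p × Fin p)) (hX₀ : X₀.PosDef) :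
    ∃ X, IsQUICSequence S Λ σ β fixed X₀ X := by
  have hnext : ∀ X : {X : Matrix (Fin p) (Fin p) ℝ // X.PosDef},
      ∃ X' : {X : Matrix (Fin p) (Fin p) ℝ // X.PosDef}, ∃ (D : Matrix (Fin p) (Fin p) ℝ) (α : ℝ),
        IsNewtonDirection S Λ X.1 (fixed X.1)ᶜ D ∧ IsArmijoStep S Λ σ β X.1 D α ∧
        X'.1 = X.1 + α • D := by
    rintro ⟨X, hX⟩
    obtain ⟨D, hD⟩ := exists_isNewtonDirection (S := S) hΛ hX (fixed X)ᶜ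
    obtain ⟨α, hα⟩ := exists_isArmijoStep hS hΛ hX hD hσ hβ
    exact ⟨⟨_, hα.lineSearchCondition.1⟩, D, α, hD, hα, rfl⟩
  choose next hnext using hnext
  exact ⟨fun t => (next^[t] ⟨X₀, hX₀⟩).1, rfl, fun t => by
    rw [Function.iterate_succ_apply']; exact hnext _⟩

/-- Newton directions are bounded in terms of bounds on the iterate and its inverse. -/
theorem IsNewtonDirection.norm_le {X D : Matrix (Fin p) (Fin p) ℝ} {J : Set (Fin p × Fin p)}
    (hΛ : ∀ i j, 0 ≤ Λ i j) (hX : X.PosDef) (hD : IsNewtonDirection S Λ X J D) {T V : ℝ}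
    (hT : X.trace ≤ T) (hV : ‖X⁻¹‖ ≤ V) : ‖D‖ ≤ T ^ 2 * (‖S‖ + V + ‖Λ‖) := by
  have hδ := hD.predictedDecrease_le hΛ
  rw [predictedDecrease] at hδ
  have h1 := (abs_le.1 (abs_trace_transpose_mul_le (gradient S X) D)).1
  have h2 := weightedL1_sub_le hΛ X D
  have h3 : ‖gradient S X‖ * ‖D‖ ≤ (‖S‖ + V) * ‖D‖ := by
    gcongr
    exact (norm_sub_le _ _).trans (by gcongr)
  have h4 : hessianForm X D ≤ (‖S‖ + V + ‖Λ‖) * ‖D‖ := by linarith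
  have hV0 : 0 ≤ V := (norm_nonneg _).trans hV
  have h5 : ‖D‖ ^ 2 ≤ T ^ 2 * ((‖S‖ + V + ‖Λ‖) * ‖D‖) := by
    refine (norm_sq_le_hessianForm hX hD.1.1).trans ?_
    have := hX.posSemidef.trace_nonneg
    have := hessianForm_nonneg hX hD.1.1
    gcongr
  rcases (norm_nonneg D).eq_or_lt with h0 | h0
  · rw [← h0]; positivity
  · refine le_of_mul_le_mul_right ?_ h0
    linarith

theorem IsQUICSequence.convergesQuadratically (hS : S.PosSemidef) (hΛs : Λ.IsSymm)
    (hΛ : ∀ i j, 0 ≤ Λ i j)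
    (hreg : ((∀ i j, i ≠ j → 0 < Λ i j) ∧ (∀ i, 0 < S i i)) ∨ (∀ i, 0 < Λ i i))
    (hσ : 0 < σ ∧ σ < 1 / 2) (hβ : 0 < β ∧ β < 1)
    (hfixed : fixed = fixedSet S Λ ∨ fixed = strictFixedSet S Λ) (hX₀ : X₀.PosDef)
    {Y : Matrix (Fin p) (Fin p) ℝ} (hY : IsMinimizer S Λ Y)
    {X : ℕ → Matrix (Fin p) (Fin p) ℝ} (hX : IsQUICSequence S Λ σ β fixed X₀ X) :
    ConvergesQuadratically X Y := by
  have hSs : S.IsSymm := by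
    rw [IsSymm, ← conjTranspose_eq_transpose_of_trivial]; exact hS.isHermitian
  obtain ⟨hinit, hstep⟩ := hX
  choose D α hD hα hnext using hstep
  have hpd : ∀ t, (X t).PosDef := fun t => by
    cases t with
    | zero => rwa [hinit]
    | succ t => rw [hnext]; exact (hα t).lineSearchCondition.1
  have hJ : ∀ t, IsFreeSet S Λ (X t) (fixed (X t))ᶜ := fun t =>
    isFreeSet_compl hSs hΛs (hpd t).isSymm hfixed
  have hH0 : ∀ t, 0 ≤ hessianForm (X t) (D t) := fun t => hessianForm_nonneg (hpd t) (hD t).1.1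
  have hδ : ∀ t, hessianForm (X t) (D t) ≤ -predictedDecrease S Λ (X t) (D t) := fun t => by
    linarith [(hD t).predictedDecrease_le hΛ]
  have hdec : ∀ t, objective S Λ (X (t + 1)) ≤ objective S Λ (X t)
      + α t * σ * predictedDecrease S Λ (X t) (D t) := fun t => by
    rw [hnext]; exact (hα t).lineSearchCondition.2
  have hα0 : ∀ t, 0 < α t := fun t => by
    obtain ⟨k, hk, -⟩ := hα t
    rw [hk]; exact pow_pos hβ.1 k
  have hanti : Antitone fun t => objective S Λ (X t) := antitone_nat_of_succ_le fun t => by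
    have := mul_nonneg (mul_pos (hα0 t) hσ.1).le ((hH0 t).trans (hδ t))
    linarith [hdec t]
  -- uniform bounds on the sublevel set
  obtain ⟨T, d, hd, hsub⟩ := exists_sublevel_subset_spectralBox hS hΛ hreg (objective S Λ (X 0))
  obtain ⟨V, hV⟩ := exists_norm_inv_le (p := p) (T := T) hd
  have hbox : ∀ t, X t ∈ spectralBox p T d := fun t => hsub _ (hpd t) (hanti (Nat.zero_le t))
  have hYbox : Y ∈ spectralBox p T d := hsub _ hY.1 (hY.2 _ (hpd 0))
  have hT0 : 0 ≤ T := hY.1.posSemidef.trace_nonneg.trans hYbox.2.1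
  have hV0 : 0 ≤ V := (norm_nonneg _).trans (hV Y hYbox)
  have hnormsq : ∀ t (E : Matrix (Fin p) (Fin p) ℝ), E.IsSymm →
      ‖E‖ ^ 2 ≤ T ^ 2 * hessianForm (X t) E := fun t E hE => by
    refine (norm_sq_le_hessianForm (hpd t) hE).trans ?_
    have h1 := (hpd t).posSemidef.trace_nonneg
    have h2 := hessianForm_nonneg (hpd t) hE
    have h3 := (hbox t).2.1
    gcongr
  have hHle : ∀ t (E : Matrix (Fin p) (Fin p) ℝ), hessianForm (X t) E ≤ V ^ 2 * ‖E‖ ^ 2 :=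
    fun t E => (hessianForm_le E).trans (by gcongr; exact hV _ (hbox t))
  set M := T ^ 2 * (‖S‖ + V + ‖Λ‖)
  have hM0 : 0 ≤ M := by positivity
  have hDM : ∀ t, ‖D t‖ ≤ M := fun t =>
    (hD t).norm_le hΛ (hpd t) (hbox t).2.1 (hV _ (hbox t))
  have hHN : ∀ t, hessianForm (X t) (D t) ≤ (V * M) ^ 2 := fun t => by
    refine (hHle t _).trans ?_
    rw [mul_pow]
    gcongr
    exact hDM t
  set a := β / (4 * (V * M + 1))
  have ha : 0 < a := div_pos hβ.1 (by positivity)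
  have hαa : ∀ t, a ≤ α t := fun t =>
    IsArmijoStep.le hSs hΛ (hpd t) (hD t) hσ hβ (by positivity) (hHN t) (hα t)
  -- the predicted decrease, hence the Newton direction, tends to zero
  have hδlim : Tendsto (fun t => -predictedDecrease S Λ (X t) (D t)) atTop (𝓝 0) := by
    have hconv := tendsto_atTop_ciInf hanti ⟨objective S Λ Y, by
      rintro _ ⟨t, rfl⟩; exact hY.2 _ (hpd t)⟩
    have hdiff : Tendsto (fun t => (objective S Λ (X t) - objective S Λ (X (t + 1))) / (a * σ))
        atTop (𝓝 0) := by
      simpa using (hconv.sub (hconv.comp (tendsto_add_atTop_nat 1))).div_const (a * σ)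
    -- Each step lowers f by at least aσ(-δ), and consecutive differences of a convergent sequence
    -- vanish.
    refine squeeze_zero (fun t => (hH0 t).trans (hδ t)) (fun t => ?_) hdiff
    rw [le_div_iff₀ (mul_pos ha hσ.1)]
    have h1 : a * σ * -predictedDecrease S Λ (X t) (D t)
        ≤ α t * σ * -predictedDecrease S Λ (X t) (D t) := by
      have := (hH0 t).trans (hδ t)
      have := hαa t
      have := hσ.1
      gcongr
    linarith [hdec t]
  have hHlim : Tendsto (fun t => hessianForm (X t) (D t)) atTop (𝓝 0) :=
    squeeze_zero hH0 hδ hδlim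
  have hNlim : Tendsto (fun t => √(hessianForm (X t) (D t))) atTop (𝓝 0) := by
    simpa using hHlim.sqrt
  have hDlim : Tendsto (fun t => ‖D t‖) atTop (𝓝 0) := by
    refine squeeze_zero (fun t => norm_nonneg _) (fun t => ?_) (by simpa using hNlim.const_mul T)
    refine le_of_sq_le_sq ?_ (by positivity)
    rw [mul_pow, Real.sq_sqrt (hH0 t)]
    exact hnormsq t _ (hD t).1.1
  -- global convergence
  have hdist : ∀ t, ‖Y - X t‖ ≤ 2 * T := fun t => by
    have h1 := (norm_le_trace hY.1).trans hYbox.2.1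
    have h2 := (norm_le_trace (hpd t)).trans (hbox t).2.1
    linarith [norm_sub_le Y (X t)]
  -- R bounds the local norm of Y - X t uniformly in t, as strong convexity requires.
  set R := V * (2 * T)
  have hR0 : 0 ≤ R := by positivity
  have herr : ∀ t, ‖Y - X t‖ ^ 2 ≤ T ^ 2 * ((4 + 2 * R) *
      (-predictedDecrease S Λ (X t) (D t) + V ^ 2 * ‖D t‖ * (2 * T + ‖D t‖))) := fun t => by
    refine (hnormsq t _ (hY.1.isSymm.sub (hpd t).isSymm)).trans ?_
    gcongr
    have hYR : hessianForm (X t) (Y - X t) ≤ R ^ 2 := by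
      refine (hHle t _).trans ?_
      rw [mul_pow]
      gcongr
      exact hdist t
    have h1 := hessianForm_sub_le hSs hΛ (hpd t) (hJ t) (hD t) hY hR0 hYR
    rw [div_le_iff₀' (by positivity)] at h1
    refine h1.trans ?_
    have := hV _ (hbox t)
    have := hdist t
    gcongr
  have hXlim : Tendsto X atTop (𝓝 Y) := by
    refine tendsto_iff_norm_sub_tendsto_zero.2 ?_
    have hlim : Tendsto (fun t => T ^ 2 * ((4 + 2 * R) *
        (-predictedDecrease S Λ (X t) (D t) + V ^ 2 * ‖D t‖ * (2 * T + ‖D t‖)))) atTop (𝓝 0) := by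
      simpa using ((hδlim.add ((hDlim.const_mul (V ^ 2)).mul (hDlim.const_add (2 * T)))).const_mul
        (4 + 2 * R)).const_mul (T ^ 2)
    have hsq := (squeeze_zero (fun t => sq_nonneg _) herr hlim).sqrt
    simpa [Real.sqrt_sq (norm_nonneg _), norm_sub_rev Y] using hsq
  -- local quadratic rate
  refine ⟨hXlim, T ^ 2 * (V ^ 2 * V) + 1, by positivity, ?_⟩
  -- Fixed entries of X t are zero, so this places Y - X t in the free subspace.
  have hsupp : ∀ᶠ t in atTop, ∀ i j, X t i j = 0 → Y i j = 0 := by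
    refine eventually_all.2 fun i => eventually_all.2 fun j => ?_
    by_cases hij : Y i j = 0
    · exact Eventually.of_forall fun _ _ => hij
    · have hlim : Tendsto (fun t => X t i j) atTop (𝓝 (Y i j)) :=
        (Continuous.tendsto (by fun_prop : Continuous fun Z : Matrix (Fin p) (Fin p) ℝ => Z i j)
          Y).comp hXlim
      filter_upwards [hlim.eventually_ne hij] with t ht h0 using absurd h0 ht
  have hσ' : 0 < (1 / 2 - σ) / 2 := by linarith [hσ.2]
  filter_upwards [hsupp, hNlim.eventually_le_const hσ'] with t ht htN
  have hone : α t = 1 := (hα t).eq_one (lineSearchCondition_one hSs hΛ (hpd t) (hD t)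
    (Real.sqrt_nonneg _) (Real.sq_sqrt (hH0 t)).ge hσ.1 (by linarith))
  have hYX : Y - X t ∈ supportedDirections (fixed (X t))ᶜ :=
    ⟨hY.1.isSymm.sub (hpd t).isSymm, fun i j h => by
      have h0 := (hJ t).eq_zero i j h
      rw [Matrix.sub_apply, ht i j h0, h0, sub_zero]⟩
  rw [frobenius_eq_norm, frobenius_eq_norm, hnext, hone, one_smul]
  -- The 1 added to the constant only ensures that it is positive.
  refine (norm_newton_step_sub_le hSs hΛ (hpd t) (hD t) hY hYX).trans ?_
  have h1 := (hpd t).posSemidef.trace_nonneg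
  have h2 := (hbox t).2.1
  have h3 := hV _ (hbox t)
  have h4 := hV _ hYbox
  have h5 : (X t).trace ^ 2 * (‖(X t)⁻¹‖ ^ 2 * ‖Y⁻¹‖) ≤ T ^ 2 * (V ^ 2 * V) := by gcongr
  gcongr
  linarith

end Convergence

end QUIC

theorem mainTheorem1 {p : ℕ} (S Λ : Matrix (Fin p) (Fin p) ℝ)
    (hS : S.PosSemidef) (hΛsymm : Λ.IsSymm) (hΛnonneg : ∀ i j, 0 ≤ Λ i j)
    (hreg : ((∀ i j, i ≠ j → 0 < Λ i j) ∧ (∀ i, 0 < S i i)) ∨ (∀ i, 0 < Λ i i))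
    (σ β : ℝ) (hσ : 0 < σ ∧ σ < 1 / 2) (hβ : 0 < β ∧ β < 1)
    (fixed : Matrix (Fin p) (Fin p) ℝ → Set (Fin p × Fin p))
    (hfixed : fixed = QUIC.fixedSet S Λ ∨ fixed = QUIC.strictFixedSet S Λ)
    (X₀ : Matrix (Fin p) (Fin p) ℝ) (hX₀ : X₀.PosDef) :
    ∃ Xstar : Matrix (Fin p) (Fin p) ℝ,
      QUIC.IsMinimizer S Λ Xstar ∧
      (∀ Y, QUIC.IsMinimizer S Λ Y → Y = Xstar) ∧
      (∃ X, QUIC.IsQUICSequence S Λ σ β fixed X₀ X) ∧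
      (∀ X, QUIC.IsQUICSequence S Λ σ β fixed X₀ X → QUIC.ConvergesQuadratically X Xstar) := by
  have hSs : S.IsSymm := by
    rw [Matrix.IsSymm, ← Matrix.conjTranspose_eq_transpose_of_trivial]; exact hS.isHermitian
  obtain ⟨Xstar, hmin⟩ := QUIC.exists_isMinimizer hS hΛnonneg hreg
  exact ⟨Xstar, hmin, fun Y hY => hmin.unique hSs hΛnonneg hY,
    QUIC.exists_isQUICSequence hSs hΛnonneg hσ hβ fixed hX₀,
    fun X hX => hX.convergesQuadratically hS hΛsymm hΛnonneg hreg hσ hβ hfixed hX₀ hmin⟩
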